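/- **Definitions.** A complete lattice $L$ is a *coherent lattice* if every element is a join of compact elements, the top $1$ is compact, and the set $K(L)$ of compact elements is closed under binary meets. The *Lawson topology* on $L$ is the topology generated by the Scott-open sets together with the sets $L\setminus{\uparrow}x$ $(x\in L)$; all topological notions below refer to it. Let $\mathsf{CohLat}_\lambda$ be the category whose objects are the coherent lattices with the Lawson topology and whose morphisms are the continuous maps $f\colon X\to Y$ that preserve finite meets (including $f(1)=1$) and whose left adjoint preserves finite meets (including the top). For $R\subseteq X\times Y$ write $R[x]=\{y : x\mathrel{R}y\}$, $R[U]=\bigcup_{x\in U}R[x]$, $R^{-1}[y]=\{x: x\mathrel{R}y\}$ and $R^{-1}[V]=\bigcup_{y\in V}R^{-1}[y]$. The relation $R$ is *interior* if all $R[x]$ and $R^{-1}[y]$ are closed, and $R[U]$, $R^{-1}[V]$ are clopen for all clopen $U\subseteq X$, $V\subseteq Y$. It is a *DH-relation* if it is interior, all the sets $Y\setminus R[x]$ and $X\setminus R^{-1}[y]$ are filters (nonempty upsets closed under binary meets), $R[x]\subseteq R[x']$ implies $x'\le x$, and $R^{-1}[y]\subseteq R^{-1}[y']$ implies $y'\le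 y$. Let $\mathsf{DH}$ be the category whose objects are the triples $(X,R,Y)$ with $X,Y$ coherent lattices and $R\subseteq X\times Y$ a DH-relation, and whose morphisms $(X_1,R_1,Y_1)\to(X_2,R_2,Y_2)$ are the pairs $(f,g)$ of $\mathsf{CohLat}_\lambda$-morphisms $f\colon X_1\to X_2$, $g\colon Y_1\to Y_2$ such that 1. $x\mathrel{R_1}y$ implies $f(x)\mathrel{R_2}g(y)$; 2. if $x'\mathrel{R_2}g(y)$, then there is $x\in X_1$ with $x\mathrel{R_1}y$ and $x'\le f(x)$; 3. if $f(x)\mathrel{R_2}y'$, then there is $y\in Y_1$ with $x\mathrel{R_1}y$ and $y'\le g(y)$; identities and composition are componentwise. For a coherent lattice $X$ let $\mathsf{OF}(X)$ be the set of open filters of $X$ ordered by inclusion (again a coherent lattice), and let $R_X\subseteq X\times\mathsf{OF}(X)$ be the relation with $x\mathrel{R_X}U$ iff $x\notin U$. Let $\mathbb E\colon\mathsf{CohLat}_\lambda\to\mathsf{DH}$ be the functor with $\mathbb E(X)=(X,R_X,\mathsf{OF}(X))$ and $\mathbb E(f)=(f,r)$, where for $f\colon X_1\to X_2$ the map $r\colon\mathsf{OF}(X_1)\to\mathsf{OF}(X_2)$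 is the right adjoint of $f^{-1}\colon\mathsf{OF}(X_2)\to\mathsf{OF}(X_1)$. Let $\mathbb F\colon\mathsf{DH}\to\mathsf{CohLat}_\lambda$ be the forgetful functor $\mathbb F(X,R,Y)=X$, $\mathbb F(f,g)=f$. **Theorem.** The functors $\mathbb E$ and $\mathbb F$ establish an equivalence of categories between $\mathsf{CohLat}_\lambda$ and $\mathsf{DH}$: there is an equivalence of categories $\mathsf{CohLat}_\lambda\simeq\mathsf{DH}$ whose functor is $\mathbb E$ and whose inverse is $\mathbb F$. -/

import Mathlib

universe u

open CategoryTheory Topology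

namespace DunnHartonas

/-! ### Coherent lattices and the Lawson topology -/

/-- A complete lattice is coherent if it is algebraic (every element is a join of compact
elements), its top element is compact, and its compact elements are closed under binary meets. -/
class IsCoherentLattice (L : Type*) [CompleteLattice L] : Prop extends
    IsCompactlyGenerated L where
  isCompactElement_top : IsCompactElement (⊤ : L)
  isCompactElement_inf : ∀ k l : L, IsCompactElement k → IsCompactElement l →
    IsCompactElement (k ⊓ l)

/-- The objects of `CohLat`: coherent lattices. -/
structure CohLat : Type (u + 1) where
  carrier : Type u
  [completeLattice : CompleteLattice carrier]
  [isCoherent : IsCoherentLattice carrier]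

namespace CohLat

instance : CoeSort CohLat.{u} (Type u) := ⟨carrier⟩

instance (X : CohLat.{u}) : CompleteLattice X := X.completeLattice

instance (X : CohLat.{u}) : IsCoherentLattice X := X.isCoherent

/-- Every coherent lattice carries its Lawson topology. -/
instance (X : CohLat.{u}) : TopologicalSpace X := Topology.lawson X

instance (X : CohLat.{u}) : Topology.IsLawson X := ⟨rfl⟩

/-- A morphism of `CohLat`: a map preserving finite meets (including the top), continuous for
the Lawson topologies, with a left adjoint that preserves finite meets. -/
@[ext]
structure Hom (X Y : CohLat.{u}) : Type u where
  hom : InfTopHom X Y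
  continuous_hom : Continuous hom
  exists_leftAdjoint : ∃ l : InfTopHom Y X, GaloisConnection l hom

instance : Category CohLat.{u} where
  Hom X Y := Hom X Y
  id X := ⟨InfTopHom.id X, continuous_id, InfTopHom.id X, GaloisConnection.id⟩
  comp f g := ⟨g.hom.comp f.hom, g.continuous_hom.comp f.continuous_hom, by
    obtain ⟨l, hl⟩ := f.exists_leftAdjoint
    obtain ⟨m, hm⟩ := g.exists_leftAdjoint
    exact ⟨l.comp m, hm.compose hl⟩⟩

end CohLat

/-! ### Dunn-Hartonas spaces -/

/-- A relation `R ⊆ X × Y` is interior if `R[x]` and `R⁻¹[y]` are closed for all points `x`, `y`,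
and `R[U]` and `R⁻¹[V]` are clopen for all clopen sets `U`, `V`. -/
structure IsInteriorRelation {X Y : Type*} [TopologicalSpace X] [TopologicalSpace Y]
    (R : X → Y → Prop) : Prop where
  isClosed_image : ∀ x, IsClosed {y | R x y}
  isClopen_image : ∀ U : Set X, IsClopen U → IsClopen {y | ∃ x ∈ U, R x y}
  isClosed_preimage : ∀ y, IsClosed {x | R x y}
  isClopen_preimage : ∀ V : Set Y, IsClopen V → IsClopen {x | ∃ y ∈ V, R x y}

/-- DH-relations: interior relations such that the complements of all `R[x]` and `R⁻¹[y]` are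
filters, `R[x] ⊆ R[x']` implies `x' ≤ x`, and `R⁻¹[y] ⊆ R⁻¹[y']` implies `y' ≤ y`. -/
structure IsDHRelation {X Y : Type*} [Preorder X] [TopologicalSpace X] [Preorder Y]
    [TopologicalSpace Y] (R : X → Y → Prop) : Prop extends IsInteriorRelation R where
  isPFilter_compl_image : ∀ x, Order.IsPFilter {y | R x y}ᶜ
  isPFilter_compl_preimage : ∀ y, Order.IsPFilter {x | R x y}ᶜ
  le_of_image_subset : ∀ x x', {y | R x y} ⊆ {y | R x' y} → x' ≤ x
  le_of_preimage_subset : ∀ y y', {x | R x y} ⊆ {x | R x y'} → y' ≤ y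

/-- The objects of `DH`: two coherent lattices joined by a DH-relation. -/
structure DHSpace : Type (u + 1) where
  X : CohLat.{u}
  Y : CohLat.{u}
  R : X → Y → Prop
  isDHRelation : IsDHRelation R

namespace DHSpace

/-- A DH-morphism `(X₁, R₁, Y₁) ⟶ (X₂, R₂, Y₂)`. -/
@[ext]
structure Hom (D₁ D₂ : DHSpace.{u}) : Type u where
  f : D₁.X ⟶ D₂.X
  g : D₁.Y ⟶ D₂.Y
  map_rel : ∀ x y, D₁.R x y → D₂.R (f.hom x) (g.hom y)
  exists_left : ∀ x' y, D₂.R x' (g.hom y) → ∃ x, D₁.R x y ∧ x' ≤ f.hom x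
  exists_right : ∀ x y', D₂.R (f.hom x) y' → ∃ y, D₁.R x y ∧ y' ≤ g.hom y

/-- In a DH-space `R⁻¹[y]` is a downset. -/
theorem rel_of_le_left (D : DHSpace.{u}) {x x' : D.X} {y : D.Y} (h : x ≤ x')
    (hR : D.R x' y) : D.R x y := by
  by_contra hn
  exact (D.isDHRelation.isPFilter_compl_preimage y).toPFilter.mem_of_le h hn hR

/-- In a DH-space `R[x]` is a downset. -/
theorem rel_of_le_right (D : DHSpace.{u}) {x : D.X} {y y' : D.Y} (h : y ≤ y')
    (hR : D.R x y') : D.R x y := by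
  by_contra hn
  exact (D.isDHRelation.isPFilter_compl_image x).toPFilter.mem_of_le h hn hR

theorem hom_mono {X Y : CohLat.{u}} (f : X ⟶ Y) : Monotone f.hom :=
  OrderHomClass.mono f.hom

instance : Category DHSpace.{u} where
  Hom D₁ D₂ := Hom D₁ D₂
  id D := ⟨𝟙 D.X, 𝟙 D.Y, fun _ _ h => h, fun x' _ h => ⟨x', h, le_rfl⟩,
    fun _ y' h => ⟨y', h, le_rfl⟩⟩
  comp p q := ⟨p.f ≫ q.f, p.g ≫ q.g, fun x y h => q.map_rel _ _ (p.map_rel x y h), by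
      intro x' y h
      obtain ⟨z, hz, hxz⟩ := q.exists_left x' (p.g.hom y) h
      obtain ⟨x, hx, hzx⟩ := p.exists_left z y hz
      exact ⟨x, hx, hxz.trans (hom_mono q.f hzx)⟩, by
      intro x y' h
      obtain ⟨z, hz, hyz⟩ := q.exists_right (p.f.hom x) y' h
      obtain ⟨y, hy, hzy⟩ := p.exists_right x z hz
      exact ⟨y, hy, hyz.trans (hom_mono q.g hzy)⟩⟩

end DHSpace

/-- The forgetful functor `F : DH ⥤ CohLat`, `(X, R, Y) ↦ X` and `(f, g) ↦ f`. -/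
def functorF : DHSpace.{u} ⥤ CohLat.{u} where
  obj D := D.X
  map p := p.f

/-! ### Open filters -/

/-- The open filters of `L`, ordered by inclusion. -/
def OF (L : Type*) [Preorder L] [TopologicalSpace L] : Type _ :=
  {U : Set L // Order.IsPFilter U ∧ IsOpen U}

namespace OF

variable {L : Type*}

instance [Preorder L] [TopologicalSpace L] : SetLike (OF L) L where
  coe U := U.1
  coe_injective := Subtype.coe_injective

instance [Preorder L] [TopologicalSpace L] : PartialOrder (OF L) := .ofSetLike (OF L) L

theorem isOpen [Preorder L] [TopologicalSpace L] (U : OF L) : IsOpen (U : Set L) := U.2.2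

theorem mem_of_le [Preorder L] [TopologicalSpace L] (U : OF L) {x y : L} (h : x ≤ y)
    (hx : x ∈ U) : y ∈ U :=
  U.2.1.toPFilter.mem_of_le h hx

theorem isUpperSet [Preorder L] [TopologicalSpace L] (U : OF L) : IsUpperSet (U : Set L) :=
  fun _ _ h hx => U.mem_of_le h hx

theorem top_mem [CompleteLattice L] [TopologicalSpace L] (U : OF L) : ⊤ ∈ U := by
  obtain ⟨x, hx⟩ := U.2.1.toPFilter.nonempty
  exact U.mem_of_le le_top hx

theorem inf_mem [CompleteLattice L] [TopologicalSpace L] (U : OF L) {x y : L}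
    (hx : x ∈ U) (hy : y ∈ U) : x ⊓ y ∈ U := by
  obtain ⟨z, hz, hzx, hzy⟩ := U.2.1.toPFilter.directed x hx y hy
  exact U.mem_of_le (le_inf hzx hzy) hz

theorem finset_inf_mem [CompleteLattice L] [TopologicalSpace L] (U : OF L) (t : Finset L)
    (ht : ∀ a ∈ t, a ∈ U) : t.inf id ∈ U :=
  Finset.inf_induction U.top_mem (fun _ ha _ hb => U.inf_mem ha hb) ht

end OF

theorem isPFilter_of {L : Type*} [CompleteLattice L] {U : Set L} (htop : ⊤ ∈ U)
    (hup : IsUpperSet U) (hinf : ∀ x ∈ U, ∀ y ∈ U, x ⊓ y ∈ U) : Order.IsPFilter U :=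
  .of_def ⟨⊤, htop⟩ (fun x hx y hy => ⟨x ⊓ y, hinf x hx y hy, inf_le_left, inf_le_right⟩)
    (fun h hx => hup h hx)

theorem directed_compact {L : Type*} [CompleteLattice L] (x : L) : DirectedOn (· ≤ ·) {k : L | IsCompactElement k ∧ k ≤ x} := by
  classical
  intro a ha b hb
  refine ⟨a ⊔ b, ⟨?_, sup_le ha.2 hb.2⟩, le_sup_left, le_sup_right⟩
  have := CompleteLattice.isCompactElement_finsetSup (f := id) ({a, b} : Finset L) (by
    intro c hc
    rcases Finset.mem_insert.1 hc with rfl | hc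
    · exact ha.1
    · rw [Finset.mem_singleton.1 hc]
      exact hb.1)
  simpa using this

theorem isCompactElement_bot' {L : Type*} [CompleteLattice L] : IsCompactElement (⊥ : L) := by
  intro s u hs _ _ _
  obtain ⟨x, hx⟩ := hs
  exact ⟨x, hx, bot_le⟩

section Lawson

variable {L : Type*} [CompleteLattice L] [TopologicalSpace L] [IsLawson L]

theorem isOpen_of_scott {U : Set L} (h : IsOpen[scott L Set.univ] U) : IsOpen U := by
  rw [IsLawson.topology_eq_lawson (α := L)]
  exact lawson_le_scott _ h

theorem isOpen_iff_scott {U : Set L} (hU : IsUpperSet U) : IsOpen U ↔ DirSupInacc U := by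
  have e : IsOpen U ↔ IsOpen[scott L Set.univ] U :=
    @lawsonOpen_iff_scottOpen_of_isUpperSet' L _ _ (scott L Set.univ) _
      (@IsScott.mk L Set.univ _ (scott L Set.univ) rfl) U hU
  rw [e, @IsScott.isOpen_iff_isUpperSet_and_dirSupInaccOn L Set.univ _ (scott L Set.univ) U
    (@IsScott.mk L Set.univ _ (scott L Set.univ) rfl), dirSupInaccOn_univ]
  exact ⟨fun h => h.2, fun h => ⟨hU, h⟩⟩

/-- In an algebraic lattice, an upset is open iff it is a union of sets `↑k` with `k` compact. -/
theorem isOpen_upper_iff [IsCompactlyGenerated L] {U : Set L} (hU : IsUpperSet U) :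
    IsOpen U ↔ ∀ x ∈ U, ∃ k, IsCompactElement k ∧ k ≤ x ∧ k ∈ U := by
  rw [isOpen_iff_scott hU]
  constructor
  · intro h x hx
    have hl : IsLUB {k : L | IsCompactElement k ∧ k ≤ x} x := by
      rw [isLUB_iff_sSup_eq]
      exact sSup_compact_le_eq x
    have hne : {k : L | IsCompactElement k ∧ k ≤ x}.Nonempty :=
      ⟨⊥, isCompactElement_bot', bot_le⟩
    obtain ⟨k, hk, hkU⟩ := h hne (directed_compact x) hl hx
    exact ⟨k, hk.1, hk.2, hkU⟩
  · intro h d hd hdir a ha haU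
    obtain ⟨k, hk, hka, hkU⟩ := h a haU
    obtain ⟨x, hx, hkx⟩ := hk d a hd hdir ha hka
    exact ⟨x, hx, hU hkx hkU⟩

theorem isClosed_Ici' (a : L) : IsClosed (Set.Ici a) := by
  rw [← isOpen_compl_iff, IsLawson.topology_eq_lawson (α := L)]
  exact lawson_le_lower _ (TopologicalSpace.isOpen_generateFrom_of_mem ⟨a, rfl⟩)

theorem isOpen_Ici_iff [IsCompactlyGenerated L] (a : L) :
    IsOpen (Set.Ici a) ↔ IsCompactElement a := by
  rw [isOpen_upper_iff (isUpperSet_Ici a)]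
  constructor
  · intro h
    obtain ⟨k, hk, hka, hak⟩ := h a le_rfl
    rwa [← le_antisymm hka hak]
  · intro h x hx
    exact ⟨a, h, hx, le_rfl⟩

theorem isClopen_Ici [IsCompactlyGenerated L] {a : L} (ha : IsCompactElement a) :
    IsClopen (Set.Ici a) :=
  ⟨isClosed_Ici' a, (isOpen_Ici_iff a).2 ha⟩

/-- The Lawson topology of a complete lattice is compact. -/
theorem compactSpace_of_isLawson : CompactSpace L := by
  refine ⟨isCompact_iff_ultrafilter_le_nhds.2 fun F _ => ?_⟩
  let S : Set L := {a | ∃ A ∈ F, a = sInf A}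
  have hdir : DirectedOn (· ≤ ·) S := by
    rintro _ ⟨A, hA, rfl⟩ _ ⟨B, hB, rfl⟩
    exact ⟨_, ⟨A ∩ B, Filter.inter_mem hA hB, rfl⟩, sInf_le_sInf Set.inter_subset_left,
      sInf_le_sInf Set.inter_subset_right⟩
  refine ⟨sSup S, Set.mem_univ _, ?_⟩
  rw [(IsLawson.isTopologicalBasis L).nhds_hasBasis.ge_iff]
  rintro _ ⟨⟨t, ht, u, hu, rfl⟩, hxu, hxt⟩
  rw [@IsScott.isOpen_iff_isUpperSet_and_dirSupInaccOn L Set.univ _ (scott L Set.univ) u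
    (@IsScott.mk L Set.univ _ (scott L Set.univ) rfl), dirSupInaccOn_univ] at hu
  refine Filter.inter_mem ?_ ?_
  · have hne : S.Nonempty := ⟨_, Set.univ, Filter.univ_mem, rfl⟩
    obtain ⟨_, ⟨A, hA, rfl⟩, hAu⟩ := hu.2 hne hdir (isLUB_sSup S) hxu
    exact Filter.mem_of_superset hA fun a ha => hu.1 (sInf_le ha) hAu
  · have : (upperClosure t : Set L) = ⋃ a ∈ t, Set.Ici a := by
      ext; simp
    change (↑(upperClosure t) : Set L)ᶜ ∈ (F : Filter L)
    rw [this]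
    refine Ultrafilter.compl_mem_iff_notMem.2 fun hmem => ?_
    rw [Ultrafilter.finite_biUnion_mem_iff ht] at hmem
    obtain ⟨a, hat, ha⟩ := hmem
    refine hxt ⟨a, hat, le_trans ?_ (le_sSup ⟨_, ha, rfl⟩)⟩
    exact le_sInf fun _ h => h

/-- A clopen set contains finitely many compact elements below all of its elements. -/
theorem exists_finset_of_isClopen [IsCompactlyGenerated L] {C : Set L} (hC : IsClopen C) :
    ∃ t : Finset L, (∀ k ∈ t, IsCompactElement k ∧ k ∈ C) ∧ ∀ x ∈ C, ∃ k ∈ t, k ≤ x := by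
  classical
  have : CompactSpace L := compactSpace_of_isLawson
  have h1 : ∀ x ∈ C, ∃ k, (IsCompactElement k ∧ k ∈ C) ∧ k ≤ x := by
    intro x hx
    obtain ⟨_, ⟨s, hs, u, hu, rfl⟩, ⟨hxu, hxs⟩, hsub⟩ :=
      (IsLawson.isTopologicalBasis L).exists_subset_of_mem_open hx hC.2
    have huu : IsUpperSet u := @IsScott.isUpperSet_of_isOpen L Set.univ _ (scott L Set.univ) u
      (@IsScott.mk L Set.univ _ (scott L Set.univ) rfl) hu
    obtain ⟨k, hk, hkx, hku⟩ := (isOpen_upper_iff huu).1 (isOpen_of_scott hu) x hxu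
    exact ⟨k, ⟨hk, hsub ⟨hku, fun h => hxs ((upperClosure s).upper hkx h)⟩⟩, hkx⟩
  obtain ⟨t, ht⟩ := hC.1.isCompact.elim_finite_subcover
    (fun k : {k : L // IsCompactElement k ∧ k ∈ C} => Set.Ici k.1)
    (fun k => (isOpen_Ici_iff _).2 k.2.1) (by
      intro x hx
      obtain ⟨k, hk, hkx⟩ := h1 x hx
      exact Set.mem_iUnion.2 ⟨⟨k, hk⟩, hkx⟩)
  refine ⟨t.image Subtype.val, ?_, ?_⟩
  · intro k hk
    obtain ⟨j, _, rfl⟩ := Finset.mem_image.1 hk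
    exact j.2
  · intro x hx
    obtain ⟨k, hk, hkx⟩ := Set.mem_iUnion₂.1 (ht hx)
    exact ⟨k.1, Finset.mem_image_of_mem _ hk, hkx⟩

/-- The Scott-type criterion for Lawson continuity. -/
theorem continuous_of_preimage {M : Type*} [CompleteLattice M] [TopologicalSpace M] [IsLawson M]
    {f : M → L} (h₁ : ∀ a, IsClosed (f ⁻¹' Set.Ici a))
    (h₂ : ∀ U : Set L, IsUpperSet U → IsOpen U → IsOpen (f ⁻¹' U)) : Continuous f := by
  rw [IsLawson.topology_eq_lawson (α := L), lawson, continuous_iff_coinduced_le, le_inf_iff,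
    ← continuous_iff_coinduced_le, ← continuous_iff_coinduced_le]
  constructor
  · refine continuous_generateFrom_iff.2 ?_
    rintro _ ⟨a, rfl⟩
    exact (h₁ a).isOpen_compl
  · refine @Continuous.mk _ _ _ (scott L Set.univ) _ fun U hU => h₂ U ?_ (isOpen_of_scott hU)
    exact @IsScott.isUpperSet_of_isOpen L Set.univ _ (scott L Set.univ) U
      (@IsScott.mk L Set.univ _ (scott L Set.univ) rfl) hU

end Lawson

namespace OF

theorem isCompactElement_finsetInf {L : Type*} [CompleteLattice L] [IsCoherentLattice L]
    (t : Finset L) (ht : ∀ a ∈ t, IsCompactElement a) :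
    IsCompactElement (t.inf id) :=
  Finset.inf_induction IsCoherentLattice.isCompactElement_top
    (fun a ha b hb => IsCoherentLattice.isCompactElement_inf a b ha hb) ht

section Coherent

variable {L : Type*} [CompleteLattice L] [TopologicalSpace L] [IsLawson L] [IsCoherentLattice L]

/-- The principal filter `↑k` of a compact element. -/
def principal (k : L) (hk : IsCompactElement k) : OF L :=
  ⟨Set.Ici k, isPFilter_of le_top (isUpperSet_Ici k) fun _ hx _ hy => le_inf hx hy,
    (isOpen_Ici_iff k).2 hk⟩

theorem mem_principal {k : L} (hk : IsCompactElement k) {x : L} :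
    x ∈ principal k hk ↔ k ≤ x := Iff.rfl

theorem principal_le_iff {k : L} (hk : IsCompactElement k) {U : OF L} :
    principal k hk ≤ U ↔ k ∈ U :=
  ⟨fun h => h (le_refl k), fun h _ hx => U.mem_of_le hx h⟩

theorem exists_compact_mem (U : OF L) {x : L} (hx : x ∈ U) :
    ∃ k, IsCompactElement k ∧ k ≤ x ∧ k ∈ U :=
  (isOpen_upper_iff U.isUpperSet).1 U.isOpen x hx

/-- The filter generated by the union of a family of open filters. -/
def join (S : Set (OF L)) : OF L :=
  ⟨{x | ∃ t : Finset L, (∀ a ∈ t, ∃ U ∈ S, a ∈ U) ∧ t.inf id ≤ x}, by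
    classical
    have hup : IsUpperSet {x | ∃ t : Finset L, (∀ a ∈ t, ∃ U ∈ S, a ∈ U) ∧ t.inf id ≤ x} :=
      fun x y hxy ⟨t, ht, htx⟩ => ⟨t, ht, htx.trans hxy⟩
    refine ⟨isPFilter_of ⟨∅, by simp, le_top⟩ hup ?_, (isOpen_upper_iff hup).2 ?_⟩
    · rintro x ⟨t, ht, htx⟩ y ⟨s, hs, hsy⟩
      refine ⟨t ∪ s, fun a ha => ?_, ?_⟩
      · rcases Finset.mem_union.1 ha with h | h
        · exact ht a h
        · exact hs a h
      · rw [Finset.inf_union]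
        exact inf_le_inf htx hsy
    · rintro x ⟨t, ht, htx⟩
      have h1 : ∀ a : t, ∃ k, (IsCompactElement k ∧ ∃ U ∈ S, k ∈ U) ∧ k ≤ (a : L) := by
        rintro ⟨a, ha⟩
        obtain ⟨U, hU, haU⟩ := ht a ha
        obtain ⟨k, hk, hka, hkU⟩ := U.exists_compact_mem haU
        exact ⟨k, ⟨hk, U, hU, hkU⟩, hka⟩
      choose k hk hka using h1
      have hle : (t.attach.image k).inf id ≤ x := by
        refine le_trans (Finset.le_inf fun a ha => ?_) htx
        exact (Finset.inf_le (Finset.mem_image_of_mem k (Finset.mem_attach t ⟨a, ha⟩))).trans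
          (hka ⟨a, ha⟩)
      refine ⟨(t.attach.image k).inf id, isCompactElement_finsetInf _ ?_, hle,
        t.attach.image k, ?_, le_rfl⟩
      · intro a ha
        obtain ⟨b, _, rfl⟩ := Finset.mem_image.1 ha
        exact (hk b).1
      · intro a ha
        obtain ⟨b, _, rfl⟩ := Finset.mem_image.1 ha
        exact (hk b).2⟩

theorem mem_join {S : Set (OF L)} {x : L} :
    x ∈ join S ↔ ∃ t : Finset L, (∀ a ∈ t, ∃ U ∈ S, a ∈ U) ∧ t.inf id ≤ x := Iff.rfl

theorem isLUB_join (S : Set (OF L)) : IsLUB S (join S) := by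
  constructor
  · intro U hU x hx
    exact mem_join.2 ⟨{x}, by simpa using ⟨U, hU, hx⟩, by simp⟩
  · rintro V hV x ⟨t, ht, htx⟩
    refine V.mem_of_le htx (V.finset_inf_mem t fun a ha => ?_)
    obtain ⟨U, hU, haU⟩ := ht a ha
    exact hV hU haU

/-- For a coherent lattice `L` the open filters form a complete lattice under inclusion. -/
noncomputable instance : CompleteLattice (OF L) :=
  letI : SupSet (OF L) := ⟨join⟩
  completeLatticeOfSup (OF L) isLUB_join

theorem mem_sSup {S : Set (OF L)} {x : L} :
    x ∈ sSup S ↔ ∃ t : Finset L, (∀ a ∈ t, ∃ U ∈ S, a ∈ U) ∧ t.inf id ≤ x := by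
  rw [← mem_join, (isLUB_sSup S).unique (isLUB_join S)]

theorem mem_top (x : L) : x ∈ (⊤ : OF L) :=
  (le_top : (principal ⊥ isCompactElement_bot' : OF L) ≤ ⊤) (bot_le : ⊥ ≤ x)

theorem mem_inf {U V : OF L} {x : L} : x ∈ U ⊓ V ↔ x ∈ U ∧ x ∈ V := by
  refine ⟨fun h => ⟨(inf_le_left : U ⊓ V ≤ U) h, (inf_le_right : U ⊓ V ≤ V) h⟩, fun h => ?_⟩
  let W : OF L := ⟨(U : Set L) ∩ V, isPFilter_of ⟨U.top_mem, V.top_mem⟩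
    (U.isUpperSet.inter V.isUpperSet)
    fun a ha b hb => ⟨U.inf_mem ha.1 hb.1, V.inf_mem ha.2 hb.2⟩, U.isOpen.inter V.isOpen⟩
  have hW : W ≤ U ⊓ V := le_inf (fun _ hx => hx.1) (fun _ hx => hx.2)
  exact hW h

theorem isCompactElement_principal {k : L} (hk : IsCompactElement k) :
    IsCompactElement (principal k hk) := by
  classical
  rw [CompleteLattice.isCompactElement_iff_exists_le_sSup_of_le_sSup]
  intro S hS
  obtain ⟨t, ht, htk⟩ := mem_sSup.1 ((principal_le_iff hk).1 hS)
  have h1 : ∀ a : t, ∃ U ∈ S, (a : L) ∈ U := fun a => ht a a.2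
  choose U hU haU using h1
  refine ⟨t.attach.image U, ?_, (principal_le_iff hk).2 ?_⟩
  · intro V hV
    obtain ⟨b, _, rfl⟩ := Finset.mem_image.1 hV
    exact hU b
  · refine mem_of_le _ htk (finset_inf_mem _ t fun a ha => ?_)
    have : U ⟨a, ha⟩ ≤ (t.attach.image U).sup id :=
      Finset.le_sup (f := id) (Finset.mem_image_of_mem U (Finset.mem_attach t ⟨a, ha⟩))
    exact this (haU ⟨a, ha⟩)

theorem sSup_principal (U : OF L) :
    sSup {V | ∃ k, ∃ hk : IsCompactElement k, k ∈ U ∧ V = principal k hk} = U := by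
  refine le_antisymm (sSup_le ?_) ?_
  · rintro _ ⟨k, hk, hkU, rfl⟩
    exact (principal_le_iff hk).2 hkU
  · intro x hx
    obtain ⟨k, hk, hkx, hkU⟩ := U.exists_compact_mem hx
    have hmem : principal k hk ∈
        {V | ∃ k, ∃ hk : IsCompactElement k, k ∈ U ∧ V = principal k hk} := ⟨k, hk, hkU, rfl⟩
    exact le_sSup hmem hkx

theorem exists_principal_of_isCompactElement {U : OF L} (hU : IsCompactElement U) :
    ∃ k, ∃ hk : IsCompactElement k, U = principal k hk := by
  have hdir : DirectedOn (· ≤ ·)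
      {V | ∃ k, ∃ hk : IsCompactElement k, k ∈ U ∧ V = principal k hk} := by
    rintro _ ⟨k, hk, hkU, rfl⟩ _ ⟨l, hl, hlU, rfl⟩
    refine ⟨_, ⟨k ⊓ l, IsCoherentLattice.isCompactElement_inf k l hk hl, U.inf_mem hkU hlU, rfl⟩,
      ?_, ?_⟩
    · exact (principal_le_iff hk).2 inf_le_left
    · exact (principal_le_iff hl).2 inf_le_right
  have hne : {V | ∃ k, ∃ hk : IsCompactElement k, k ∈ U ∧ V = principal k hk}.Nonempty :=
    ⟨_, ⊤, IsCoherentLattice.isCompactElement_top, U.top_mem, rfl⟩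
  obtain ⟨_, ⟨k, hk, hkU, rfl⟩, h⟩ := hU _ U hne hdir
    (isLUB_iff_sSup_eq.2 U.sSup_principal) le_rfl
  exact ⟨k, hk, le_antisymm h ((principal_le_iff hk).2 hkU)⟩

theorem isCompactElement_sup' {k l : L} (hk : IsCompactElement k) (hl : IsCompactElement l) :
    IsCompactElement (k ⊔ l) := by
  rw [← isOpen_Ici_iff, ← Set.Ici_inter_Ici]
  exact ((isOpen_Ici_iff k).2 hk).inter ((isOpen_Ici_iff l).2 hl)

instance : IsCoherentLattice (OF L) where
  exists_sSup_eq U := by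
    refine ⟨{V | ∃ k, ∃ hk : IsCompactElement k, k ∈ U ∧ V = principal k hk}, ?_,
      U.sSup_principal⟩
    rintro _ ⟨k, hk, _, rfl⟩
    exact isCompactElement_principal hk
  isCompactElement_top := by
    have : (⊤ : OF L) = principal ⊥ isCompactElement_bot' :=
      le_antisymm (fun _ _ => bot_le) le_top
    rw [this]
    exact isCompactElement_principal _
  isCompactElement_inf U V hU hV := by
    obtain ⟨k, hk, rfl⟩ := exists_principal_of_isCompactElement hU
    obtain ⟨l, hl, rfl⟩ := exists_principal_of_isCompactElement hV
    have : principal k hk ⊓ principal l hl = principal (k ⊔ l) (isCompactElement_sup' hk hl) := by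
      refine SetLike.ext fun x => ?_
      rw [mem_inf, mem_principal, mem_principal, mem_principal, sup_le_iff]
    rw [this]
    exact isCompactElement_principal _

end Coherent

end OF

/-- The coherent lattice of open filters of a coherent lattice. -/
noncomputable def openFilters (X : CohLat.{u}) : CohLat.{u} := ⟨OF X⟩

/-- The relation `R_X ⊆ X × OF(X)`: `x R_X U` iff `x ∉ U`. -/
def relOF (X : CohLat.{u}) (x : X) (U : OF X) : Prop := x ∉ U

theorem isDHRelation_relOF (X : CohLat.{u}) :
    IsDHRelation (X := X) (Y := openFilters X) (relOF X) where
  isClosed_image x := by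
    have hup : IsUpperSet {U : openFilters X | relOF X x U}ᶜ := by
      intro U V hUV hU hV
      exact hU fun h => hV (hUV h)
    rw [← isOpen_compl_iff, isOpen_upper_iff hup]
    intro U hU
    obtain ⟨k, hk, hkx, hkU⟩ := OF.exists_compact_mem U (not_not.1 hU)
    exact ⟨OF.principal k hk, OF.isCompactElement_principal hk,
      (OF.principal_le_iff hk).2 hkU, fun h => h hkx⟩
  isClopen_image C hC := by
    obtain ⟨t, ht, htC⟩ := exists_finset_of_isClopen hC
    have hk : IsCompactElement (t.inf id) :=
      OF.isCompactElement_finsetInf t fun a ha => (ht a ha).1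
    have : {U : openFilters X | ∃ x ∈ C, relOF X x U}ᶜ =
        Set.Ici (α := openFilters X) (OF.principal (t.inf id) hk) := by
      ext U
      refine Iff.trans ?_ (OF.principal_le_iff (U := U) hk).symm
      constructor
      · intro h
        exact OF.finset_inf_mem _ t fun a ha => by
          by_contra hn
          exact h ⟨a, (ht a ha).2, hn⟩
      · rintro h ⟨x, hx, hxU⟩
        obtain ⟨k, hkt, hkx⟩ := htC x hx
        exact hxU (OF.mem_of_le U ((Finset.inf_le hkt).trans hkx) h)
    rw [← isClopen_compl_iff, this]
    exact isClopen_Ici (L := openFilters X) (OF.isCompactElement_principal hk)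
  isClosed_preimage U := by
    exact (OF.isOpen (L := X) U).isClosed_compl
  isClopen_preimage C hC := by
    obtain ⟨t, ht, htC⟩ := exists_finset_of_isClopen hC
    have h1 : ∀ U : t, ∃ k, ∃ hk : IsCompactElement k, U.1 = OF.principal (L := X) k hk :=
      fun U => OF.exists_principal_of_isCompactElement (ht U U.2).1
    choose k hk hU using h1
    have : {x : X | ∃ U ∈ C, relOF X x U}ᶜ = ⋂ U : t, Set.Ici (k U) := by
      ext x
      rw [Set.mem_iInter]
      constructor
      · intro h U
        have hx : (show OF X from U.1).1 x := by
          by_contra hn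
          exact h ⟨U.1, (ht U U.2).2, hn⟩
        rw [hU U] at hx
        exact hx
      · rintro h ⟨V, hV, hxV⟩
        obtain ⟨U, hUt, hUV⟩ := htC V hV
        have hx : (show OF X from U).1 x := by
          have := hU ⟨U, hUt⟩
          dsimp only at this
          rw [this]
          exact h ⟨U, hUt⟩
        exact hxV (hUV hx)
    rw [← isClopen_compl_iff, this]
    exact isClopen_iInter_of_finite fun U => isClopen_Ici (hk U)
  isPFilter_compl_image x :=
    isPFilter_of (L := openFilters X) (not_not.2 (OF.mem_top x))
      (fun U V hUV hU hV => hU fun h => hV (hUV h))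
      (fun U hU V hV => not_not.2 (OF.mem_inf.2 ⟨not_not.1 hU, not_not.1 hV⟩))
  isPFilter_compl_preimage U :=
    isPFilter_of (not_not.2 (OF.top_mem U))
      (fun x y hxy hx hy => hx fun h => hy (OF.mem_of_le U hxy h))
      (fun x hx y hy => not_not.2 (OF.inf_mem U (not_not.1 hx) (not_not.1 hy)))
  le_of_image_subset x x' h := by
    rw [le_iff_compact_le_imp]
    intro k hk hkx'
    by_contra hn
    exact h (show relOF X x (OF.principal k hk) from hn) hkx'
  le_of_preimage_subset U U' h := by
    intro x hx
    by_contra hn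
    exact h (show relOF X x U from hn) hx

section Maps

variable {X Y : CohLat.{u}}

/-- The preimage map `f⁻¹ : OF(Y) → OF(X)`. -/
def preimageOF (f : X ⟶ Y) (W : OF Y) : OF X :=
  ⟨f.hom ⁻¹' W, isPFilter_of
    (show f.hom ⊤ ∈ W by rw [map_top]; exact W.top_mem)
    (fun _ _ h hx => W.mem_of_le (DHSpace.hom_mono f h) hx)
    (fun x hx y hy => show f.hom (x ⊓ y) ∈ W by rw [map_inf]; exact W.inf_mem hx hy),
    W.isOpen.preimage f.continuous_hom⟩

/-- The map `r : OF(X) → OF(Y)`, `r(U) = ⋁ {W | f⁻¹(W) ⊆ U}`. -/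
noncomputable def rightAdjointOF (f : X ⟶ Y) (U : OF X) : OF Y :=
  sSup {W | preimageOF f W ≤ U}

theorem mem_rightAdjointOF (f : X ⟶ Y) (l : InfTopHom Y X) (hl : GaloisConnection l f.hom)
    (U : OF X) (y : Y) : y ∈ rightAdjointOF f U ↔ l y ∈ U := by
  constructor
  · intro hy
    obtain ⟨t, ht, hty⟩ := OF.mem_sSup.1 hy
    refine U.mem_of_le (OrderHomClass.mono l hty) ?_
    rw [map_finset_inf]
    refine Finset.inf_induction U.top_mem (fun _ ha _ hb => U.inf_mem ha hb) fun a ha => ?_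
    obtain ⟨W, hW, haW⟩ := ht a ha
    exact hW (show f.hom (l a) ∈ W from W.mem_of_le (hl.le_u_l a) haW)
  · intro hy
    obtain ⟨k, hk, hkl, hkU⟩ := U.exists_compact_mem hy
    have hup : IsUpperSet {z : Y | l z ∈ U} := fun a b hab ha =>
      U.mem_of_le (OrderHomClass.mono l hab) ha
    have hop : IsOpen {z : Y | l z ∈ U} := by
      rw [isOpen_iff_scott hup]
      intro d hd hdir a ha haU
      obtain ⟨k, hk, hkl, hkU⟩ := U.exists_compact_mem haU
      have hlub := hl.isLUB_l_image ha
      obtain ⟨_, ⟨x, hx, rfl⟩, hkx⟩ := hk (l '' d) (l a) (hd.image _)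
        (by
          rintro _ ⟨p, hp, rfl⟩ _ ⟨q, hq, rfl⟩
          obtain ⟨r, hr, hpr, hqr⟩ := hdir p hp q hq
          exact ⟨l r, ⟨r, hr, rfl⟩, OrderHomClass.mono l hpr, OrderHomClass.mono l hqr⟩)
        hlub hkl
      exact ⟨x, hx, U.mem_of_le hkx hkU⟩
    let W : OF Y := ⟨{z : Y | l z ∈ U}, isPFilter_of
      (show l ⊤ ∈ U by rw [map_top]; exact U.top_mem) hup
      (fun a ha b hb => show l (a ⊓ b) ∈ U by rw [map_inf]; exact U.inf_mem ha hb), hop⟩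
    have hW : preimageOF f W ≤ U := fun x hx => U.mem_of_le (hl.l_u_le x) hx
    exact (le_sSup (a := W) hW) hy

/-- `r` is the right adjoint of `f⁻¹`. -/
theorem gc_preimageOF (f : X ⟶ Y) : GaloisConnection (preimageOF f) (rightAdjointOF f) := by
  obtain ⟨l, hl⟩ := f.exists_leftAdjoint
  intro W U
  refine ⟨fun h => le_sSup h, fun h x hx => ?_⟩
  have := (mem_rightAdjointOF f l hl U _).1 (h hx)
  exact U.mem_of_le (hl.l_u_le x) this

/-- The left adjoint of a morphism of coherent lattices preserves compact elements. -/
theorem isCompactElement_leftAdjoint (f : X ⟶ Y) (l : InfTopHom Y X)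
    (hl : GaloisConnection l f.hom) {k : Y} (hk : IsCompactElement k) :
    IsCompactElement (l k) := by
  rw [← isOpen_Ici_iff]
  have : Set.Ici (l k) = f.hom ⁻¹' Set.Ici k := by
    ext x
    exact hl k x
  rw [this]
  exact ((isOpen_Ici_iff k).2 hk).preimage f.continuous_hom

theorem continuous_rightAdjointOF (f : X ⟶ Y) :
    Continuous (X := openFilters X) (Y := openFilters Y) (rightAdjointOF f) := by
  obtain ⟨l, hl⟩ := f.exists_leftAdjoint
  refine continuous_of_preimage (L := openFilters Y) (M := openFilters X) ?_ ?_
  · intro W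
    have : rightAdjointOF f ⁻¹' Set.Ici (α := openFilters Y) W =
        Set.Ici (α := openFilters X) (preimageOF f W) := by
      ext U
      exact (gc_preimageOF f W U).symm
    exact this ▸ isClosed_Ici' (L := openFilters X) (preimageOF f W)
  · intro O hO hOo
    have hup : IsUpperSet (α := openFilters X) (rightAdjointOF f ⁻¹' O) :=
      fun U V h hU => hO ((gc_preimageOF f).monotone_u h) hU
    refine (isOpen_upper_iff (L := openFilters X) hup).2 fun U hU => ?_
    obtain ⟨V, hV, hVU, hVO⟩ := (isOpen_upper_iff (L := openFilters Y) hO).1 hOo _ hU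
    obtain ⟨k, hk, rfl⟩ := OF.exists_principal_of_isCompactElement hV
    have hlk := isCompactElement_leftAdjoint f l hl hk
    refine ⟨OF.principal (l k) hlk, OF.isCompactElement_principal hlk,
      (OF.principal_le_iff hlk).2 ?_, ?_⟩
    · exact (mem_rightAdjointOF f l hl U k).1 ((OF.principal_le_iff hk).1 hVU)
    · refine hO ?_ hVO
      exact (OF.principal_le_iff hk).2 ((mem_rightAdjointOF f l hl _ k).2 le_rfl)

/-- The right adjoint `r` of `f⁻¹`, as a morphism of coherent lattices. -/
noncomputable def rightAdjointHom (f : X ⟶ Y) : openFilters X ⟶ openFilters Y where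
  hom :=
    { toFun := rightAdjointOF f
      map_inf' := fun _ _ => (gc_preimageOF f).u_inf
      map_top' := (gc_preimageOF f).u_top }
  continuous_hom := continuous_rightAdjointOF f
  exists_leftAdjoint :=
    ⟨{ toFun := preimageOF f
       map_inf' := fun U V => SetLike.ext (A := OF X) fun _ =>
        Iff.trans (OF.mem_inf (U := U) (V := V)) (OF.mem_inf (U := preimageOF f U) (V := preimageOF f V)).symm
       map_top' := SetLike.ext (A := OF X) fun x => iff_of_true (OF.mem_top (f.hom x)) (OF.mem_top x) },
      gc_preimageOF f⟩

end Maps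

/-- The functor `E : CohLat ⥤ DH`, `X ↦ (X, R_X, OF(X))` and `f ↦ (f, r)` with `r` the right
adjoint of `f⁻¹`. -/
noncomputable def functorE : CohLat.{u} ⥤ DHSpace.{u} where
  obj X := ⟨X, openFilters X, relOF X, isDHRelation_relOF X⟩
  map {X Y} f :=
    { f := f
      g := rightAdjointHom f
      map_rel := by
        obtain ⟨l, hl⟩ := f.exists_leftAdjoint
        intro x U h hn
        exact h (OF.mem_of_le U (hl.l_u_le x) ((mem_rightAdjointOF f l hl U _).1 hn))
      exists_left := by
        obtain ⟨l, hl⟩ := f.exists_leftAdjoint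
        intro x' U h
        exact ⟨l x', fun hn => h ((mem_rightAdjointOF f l hl U _).2 hn), hl.le_u_l x'⟩
      exists_right := by
        intro x V h
        exact ⟨preimageOF f V, h, (gc_preimageOF f).le_u_l V⟩ }
  map_id X := by
    refine DHSpace.Hom.ext rfl (CohLat.Hom.ext (InfTopHom.ext fun U => ?_))
    exact SetLike.ext (A := OF X) fun x => mem_rightAdjointOF (𝟙 X) (InfTopHom.id X) GaloisConnection.id U x
  map_comp {X Y Z} f g := by
    obtain ⟨l, hl⟩ := f.exists_leftAdjoint
    obtain ⟨m, hm⟩ := g.exists_leftAdjoint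
    refine DHSpace.Hom.ext rfl (CohLat.Hom.ext (InfTopHom.ext fun U => ?_))
    refine SetLike.ext (A := OF Z) fun z => ?_
    refine (mem_rightAdjointOF (f ≫ g) (l.comp m) (hm.compose hl) U z).trans ?_
    refine Iff.trans ?_ (mem_rightAdjointOF g m hm (rightAdjointOF f U) z).symm
    exact (mem_rightAdjointOF f l hl U (m z)).symm

end DunnHartonas

/-! ### Clopen filters and order isomorphisms of lattices with the Lawson topology. -/

namespace DunnHartonas

/-! Since `functorF` undoes `functorE` on the nose, everything rests on showing that a DH-space `(X,
R, Y)` is determined, naturally, by `X`. The comparison map sends `y` to the open filter `X \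
R⁻¹[y]`. The order axioms of a DH-relation make it an order embedding of `Y` into `OF X`
(`complPreimage_le_iff`).

The main point is surjectivity. For compact `k` the set `↑k` is clopen, so interiority makes `Y \
R[k]` a clopen filter of `Y`. Lawson compactness forces such a filter to be principal, and its
generator `j` is mapped to `↑k` (`exists_complPreimage_eq_principal`). An arbitrary open filter is a
directed union of such `↑k`, and the supremum of the corresponding `j` is mapped to it, because the
sets `Y \ R[x]` are Scott open (`complPreimage_surjective`).

The Lawson topology depends on the order alone, so this order isomorphism is an isomorphism of
coherent lattices. Naturality holds because the first component of a DH-morphism determines the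
second: if `l` is left adjoint to `f`, then `x' R₂ g(y)` iff `l(x') R₁ y`. -/

/-- A clopen filter of an algebraic lattice is principal. -/
theorem exists_eq_Ici_of_isClopen {L : Type*} [CompleteLattice L] [TopologicalSpace L] [IsLawson L]
    [IsCompactlyGenerated L] {F : Set L} (hF : Order.IsPFilter F) (hc : IsClopen F) :
    ∃ k, F = Set.Ici k := by
  let U : OF L := ⟨F, hF, hc.2⟩
  obtain ⟨t, ht, htF⟩ := exists_finset_of_isClopen hc
  -- Every element of `F` lies above one of the finitely many elements of `t ⊆ F`. A filter contains
  -- their meet, which is therefore its least element.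
  refine ⟨t.inf id, Set.ext fun x => ⟨fun hx => ?_, fun hx => ?_⟩⟩
  · obtain ⟨k, hk, hkx⟩ := htF x hx
    exact (Finset.inf_le hk).trans hkx
  · exact U.mem_of_le hx (U.finset_inf_mem t fun a ha => (ht a ha).2)

/-- Order isomorphisms are continuous for the Lawson topologies. -/
theorem continuous_orderIso {L M : Type*} [CompleteLattice L] [TopologicalSpace L] [IsLawson L]
    [CompleteLattice M] [TopologicalSpace M] [IsLawson M] (e : M ≃o L) : Continuous e := by
  refine continuous_of_preimage (fun a => ?_) fun U hU hUo => ?_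
  · have : e ⁻¹' Set.Ici a = Set.Ici (e.symm a) := by
      ext x
      exact (e.symm_apply_le).symm
    rw [this]
    exact isClosed_Ici' _
  · rw [isOpen_iff_scott (hU.preimage e.monotone)]
    intro d hd hdir a ha haU
    obtain ⟨_, ⟨x, hx, rfl⟩, hxU⟩ := (isOpen_iff_scott hU).1 hUo (hd.image e)
      (hdir.mono_comp e.monotone) (e.isLUB_image'.2 ha) haU
    exact ⟨x, hx, hxU⟩

namespace CohLat

/-- The morphism of coherent lattices given by an order isomorphism. -/
def homOfOrderIso {X Y : CohLat.{u}} (e : X ≃o Y) : X ⟶ Y where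
  hom := { toFun := e, map_inf' := map_inf e, map_top' := map_top e }
  continuous_hom := continuous_orderIso e
  exists_leftAdjoint :=
    ⟨{ toFun := e.symm, map_inf' := map_inf e.symm, map_top' := map_top e.symm },
      e.symm.to_galoisConnection⟩

end CohLat

/-! ### The second lattice of a DH-space as the lattice of open filters of the first. -/

namespace DHSpace

variable (D : DHSpace.{u})

/-- The open filter `X \ R⁻¹[y]`. -/
def complPreimage (y : D.Y) : OF D.X :=
  ⟨{x | D.R x y}ᶜ, D.isDHRelation.isPFilter_compl_preimage y,
    (D.isDHRelation.isClosed_preimage y).isOpen_compl⟩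

theorem mem_complPreimage {x : D.X} {y : D.Y} : x ∈ D.complPreimage y ↔ ¬ D.R x y := Iff.rfl

/-- Complementation reverses inclusion, as does the order axiom on the sets `R⁻¹[y]`, so the two
reversals cancel. The converse uses only that each `R[x]` is a downset. -/
theorem complPreimage_le_iff {y y' : D.Y} :
    D.complPreimage y ≤ D.complPreimage y' ↔ y ≤ y' :=
  ⟨fun h => D.isDHRelation.le_of_preimage_subset y' y fun _ hx =>
      by_contra fun hn => h (D.mem_complPreimage.2 hn) hx,
    fun h _ hx hn => hx (D.rel_of_le_right h hn)⟩

/-- Every compact element `k` of `X` has a `j` in `Y` with `X \ R⁻¹[j] = ↑k`. -/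
theorem exists_complPreimage_eq_principal {k : D.X} (hk : IsCompactElement k) :
    ∃ j, D.complPreimage j = OF.principal k hk := by
  have hclopen : IsClopen {y | D.R k y}ᶜ := by
    -- Interiority gives clopen images only of clopen sets. As `R⁻¹[y]` is a downset, `R[k]` is the
    -- image of the clopen set `↑k`.
    have : {y | D.R k y} = {y | ∃ x ∈ Set.Ici k, D.R x y} := by
      ext y
      exact ⟨fun h => ⟨k, le_rfl, h⟩, fun ⟨_, hx, h⟩ => D.rel_of_le_left hx h⟩
    rw [this]
    exact (D.isDHRelation.isClopen_image _ (isClopen_Ici hk)).compl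
  obtain ⟨j, hj⟩ := exists_eq_Ici_of_isClopen (D.isDHRelation.isPFilter_compl_image k) hclopen
  have hmem : ∀ y, ¬ D.R k y ↔ j ≤ y := fun y => Set.ext_iff.1 hj y
  refine ⟨j, le_antisymm (fun x hx => ?_) ((OF.principal_le_iff hk).2 ((hmem j).2 le_rfl))⟩
  -- It suffices that `R[x] ⊆ R[k]`: if `x R y` but not `k R y`, then `j ≤ y`, so `x R j`, against
  -- the choice of `x`.
  refine D.isDHRelation.le_of_image_subset x k fun y hxy => ?_
  by_contra hn
  exact hx (D.rel_of_le_right ((hmem y).1 hn) hxy)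

/-- The preimage of `U` is the directed supremum of the preimages `j k` of the principal filters
`↑k`, for compact `k ∈ U`. -/
theorem complPreimage_surjective : Function.Surjective D.complPreimage := by
  intro U
  choose j hj using fun k : {k : D.X // IsCompactElement k} =>
    D.exists_complPreimage_eq_principal k.2
  let d : Set D.Y := j '' {k | k.1 ∈ U}
  have hdir : DirectedOn (· ≤ ·) d := by
    rintro _ ⟨k, hk, rfl⟩ _ ⟨l, hl, rfl⟩
    have hc := IsCoherentLattice.isCompactElement_inf k.1 l.1 k.2 l.2
    -- The assignment `k ↦ j k` reverses order, so the meet of two compact elements yields an upper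
    -- bound.
    refine ⟨j ⟨_, hc⟩, ⟨_, U.inf_mem hk hl, rfl⟩, ?_, ?_⟩
    · refine D.complPreimage_le_iff.1 ?_
      rw [hj, hj]
      exact (OF.principal_le_iff k.2).2 (inf_le_left : k.1 ⊓ l.1 ≤ k.1)
    · refine D.complPreimage_le_iff.1 ?_
      rw [hj, hj]
      exact (OF.principal_le_iff l.2).2 (inf_le_right : k.1 ⊓ l.1 ≤ l.1)
  have hne : d.Nonempty :=
    ⟨_, ⟨⊤, IsCoherentLattice.isCompactElement_top⟩, U.top_mem, rfl⟩
  refine ⟨sSup d, le_antisymm (fun x hx => ?_) fun x hx => ?_⟩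
  · have hup : IsUpperSet {y | D.R x y}ᶜ := fun _ _ h hy hn => hy (D.rel_of_le_right h hn)
    -- The open upset `Y \ R[x]` contains the directed supremum of `d`, hence already some `j k`,
    -- and this means `k ≤ x`.
    obtain ⟨_, ⟨k, hk, rfl⟩, hkx⟩ :=
      (isOpen_iff_scott hup).1 (D.isDHRelation.isClosed_image x).isOpen_compl hne hdir
        (isLUB_sSup d) hx
    have : x ∈ D.complPreimage (j k) := hkx
    rw [hj] at this
    exact U.mem_of_le this hk
  · obtain ⟨k, hk, hkx, hkU⟩ := U.exists_compact_mem hx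
    have hle : j ⟨k, hk⟩ ≤ sSup d := le_sSup ⟨_, hkU, rfl⟩
    refine D.complPreimage_le_iff.2 hle ?_
    rw [hj]
    exact hkx

/-- In a DH-space `(X, R, Y)`, the lattice `Y` is isomorphic to the lattice of open filters
of `X`. -/
noncomputable def orderIsoOF : D.Y ≃o OF D.X where
  toEquiv := Equiv.ofBijective D.complPreimage
    ⟨fun _ _ h => le_antisymm (D.complPreimage_le_iff.1 h.le) (D.complPreimage_le_iff.1 h.ge),
      D.complPreimage_surjective⟩
  map_rel_iff' := D.complPreimage_le_iff

theorem mem_orderIsoOF {x : D.X} {y : D.Y} : x ∈ D.orderIsoOF y ↔ ¬ D.R x y := Iff.rfl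

theorem rel_orderIsoOF_symm {x : D.X} {U : OF D.X} :
    D.R x (D.orderIsoOF.symm U) ↔ x ∉ U := by
  rw [← not_iff_not, ← mem_orderIsoOF, OrderIso.apply_symm_apply, not_not]

/-! ### The natural isomorphism and the equivalence. -/

/-- Every DH-space `(X, R, Y)` is isomorphic to `(X, R_X, OF(X))`. -/
noncomputable def isoFunctorEObj : D ≅ functorE.obj D.X where
  hom :=
    { f := 𝟙 D.X
      g := CohLat.homOfOrderIso (Y := openFilters D.X) D.orderIsoOF
      -- The relation of `x` to the image of `y` under `relOF` is the double negation of `x R y`.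
      map_rel := fun _ _ h hn => hn h
      exists_left := fun x' _ h => ⟨x', not_not.1 h, le_rfl⟩
      exists_right := fun _ U h => ⟨D.orderIsoOF.symm U, D.rel_orderIsoOF_symm.2 h,
        (D.orderIsoOF.apply_symm_apply U).ge⟩ }
  inv :=
    { f := 𝟙 D.X
      g := CohLat.homOfOrderIso (X := openFilters D.X) D.orderIsoOF.symm
      map_rel := fun _ _ h => D.rel_orderIsoOF_symm.2 h
      exists_left := fun x' _ h => ⟨x', D.rel_orderIsoOF_symm.1 h, le_rfl⟩
      exists_right := fun _ y h => ⟨D.orderIsoOF y, not_not.2 h,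
        (D.orderIsoOF.symm_apply_apply y).ge⟩ }
  hom_inv_id := DHSpace.Hom.ext rfl
    (CohLat.Hom.ext (InfTopHom.ext D.orderIsoOF.symm_apply_apply))
  inv_hom_id := DHSpace.Hom.ext rfl
    (CohLat.Hom.ext (InfTopHom.ext D.orderIsoOF.apply_symm_apply))

variable {D} in
-- First components agree trivially. For the second, both sides are open filters of `D'.X`, compared
-- pointwise through the left adjoint `l` of `p.f`.
theorem isoFunctorEObj_naturality {D' : DHSpace.{u}} (p : D ⟶ D') :
    p ≫ D'.isoFunctorEObj.hom = D.isoFunctorEObj.hom ≫ functorE.map p.f := by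
  obtain ⟨l, hl⟩ := p.f.exists_leftAdjoint
  refine DHSpace.Hom.ext rfl (CohLat.Hom.ext (InfTopHom.ext fun y => ?_))
  refine SetLike.ext (A := OF D'.X) fun x' => ?_
  refine Iff.trans ?_ (mem_rightAdjointOF p.f l hl (D.orderIsoOF y) x').symm
  refine not_congr (⟨fun h => ?_, fun h => ?_⟩ : D'.R x' (p.g.hom y) ↔ D.R (l x') y)
  -- The witness satisfies `x' ≤ f(x)`, that is `l(x') ≤ x`, and `R⁻¹[y]` is a downset.
  · obtain ⟨x, hx, hxx'⟩ := p.exists_left x' y h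
    exact D.rel_of_le_left ((hl x' x).2 hxx') hx
  -- Apply `f` to `l(x')` and descend along the unit `x' ≤ f(l(x'))`.
  · exact D'.rel_of_le_left (hl.le_u_l x') (p.map_rel _ _ h)

end DHSpace

/-- The functors `E` and `F` form an equivalence of categories. -/
noncomputable def cohLatEquivDH : CohLat.{u} ≌ DHSpace.{u} where
  functor := functorE
  inverse := functorF
  unitIso := Iso.refl _
  counitIso := (NatIso.ofComponents (F := 𝟭 DHSpace.{u}) (G := functorF ⋙ functorE)
    DHSpace.isoFunctorEObj DHSpace.isoFunctorEObj_naturality).symm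
  functor_unitIso_comp X := by
    let i : functorE.obj X ⟶ functorE.obj X := (functorE.obj X).isoFunctorEObj.inv
    -- With an identity unit, the triangle law says that the comparison at `functorE.obj X` is the
    -- identity. There it sends `U` to the complement of the complement of `U`.
    refine ((congrArg (· ≫ i) (functorE.map_id X)).trans (Category.id_comp i)).trans ?_
    refine DHSpace.Hom.ext rfl (CohLat.Hom.ext (InfTopHom.ext fun U => ?_))
    refine (functorE.obj X).orderIsoOF.symm_apply_eq.2 ?_
    exact SetLike.ext (A := OF X) fun _ => not_not.symm

end DunnHartonas

theorem mainTheorem2 :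
    ∃ e : DunnHartonas.CohLat.{u} ≌ DunnHartonas.DHSpace.{u},
      e.functor = DunnHartonas.functorE ∧ e.inverse = DunnHartonas.functorF := by
  exact ⟨DunnHartonas.cohLatEquivDH, rfl, rfl⟩
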